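/- Let $\mathbf{k}$ be a field. A (finite) hypergraph $H$ on a finite vertex set $V=V(H)$ is a collection of subsets of $V$ (edges), each with at least two elements; it is discrete if it has no edges; for $I\subset V$ let $H|_I=\{e\in H : e\subset I\}$, a hypergraph on $I$. Let $\mathcal H=\mathcal H(\mathbf H)$ be the Hopf algebra over $\mathbf{k}$ with basis the isomorphism classes of finite hypergraphs, graded by the number of vertices, with product the disjoint sum, coproduct $\Delta(H)=\sum_{I\subset V}H|_I\otimes H|_{V\setminus I}$, unit the hypergraph $H_\emptyset$ with no vertices, and counit $\epsilon(H)=1$ if $H=H_\emptyset$ and $\epsilon(H)=0$ otherwise. Let $\zeta=\zeta_{\mathbf H}$ be the character with $\zeta(H)=1$ if $H$ is discrete and $\zeta(H)=0$ otherwise; put $\overline\zeta(h)=(-1)^n\zeta(h)$ for $h\in\mathcal H_n$, and let $\zeta^{-1}=\zeta\circ S$, where $S$ is the antipode. The odd subalgebra $S_-(\mathcal H,\zeta)$ is the largest graded Hopf subalgebra of $\mathcal H$ on which $\zeta^{-1}=\overline\zeta$. Let $\chi=\overline\zeta\,\zeta$ (convolution product). A hypergraph $H$ is eulerian (over $\mathbf{k}$)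 if $\chi(H|_I)=\epsilon(H|_I)$ in $\mathbf{k}$ for all $I\subset V(H)$. For a finite sequence $\alpha=(a_1,\dots,a_m)$ of nonnegative integers let $\zeta_\alpha=\zeta_{a_1}\cdots\zeta_{a_m}$ (convolution product), where $\zeta_a$ is the projection $\mathcal H\to\mathcal H_a$ followed by $\zeta$. **Proposition.** The linear span $\mathcal E(\mathbf H)$ of the isomorphism classes of eulerian hypergraphs is a graded Hopf subalgebra of $\mathcal H(\mathbf H)$, and it is contained in $S_-(\mathcal H(\mathbf H),\zeta_{\mathbf H})$. Moreover, every eulerian hypergraph $H$ with $n$ vertices satisfies $$\sum_{j=0}^{a_i}(-1)^j\,\zeta_{(a_1,\dots,a_{i-1},\,j,\,a_i-j,\,a_{i+1},\dots,a_m)}(H)=0$$ for every composition $\alpha=(a_1,\dots,a_m)$ of $n$ (all $a_r\ge 1$) and every $i\in\{1,\dots,m\}$. -/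

import Mathlib

open scoped TensorProduct
noncomputable section
universe u v w

/-- A hypergraph on the vertex set `V`: a collection of subsets of `V` (the edges), each with at
least two vertices. -/
@[ext]
structure FinHypergraph (V : Type u) where
  edges : Set (Finset V)
  two_le_card : ∀ e ∈ edges, 2 ≤ e.card

namespace FinHypergraph

variable {V : Type u} {W : Type v} {X : Type w}

/-- The hypergraph induced on `W` along an injection of `W` into the vertex set. -/
def comap (H : FinHypergraph V) (f : W ↪ V) : FinHypergraph W where
  edges := {e | e.map f ∈ H.edges}
  two_le_card e he := by simpa using H.two_le_card _ he

/-- The restriction of `H` to the vertex set `I`: the edges of `H` contained in `I`. -/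
def restrict (H : FinHypergraph V) (I : Finset V) : FinHypergraph I :=
  H.comap (Function.Embedding.subtype (· ∈ I))

/-- The disjoint sum of two hypergraphs. -/
def sum (H : FinHypergraph V) (G : FinHypergraph W) : FinHypergraph (V ⊕ W) where
  edges := {e | (∃ a ∈ H.edges, a.map Function.Embedding.inl = e) ∨
    (∃ b ∈ G.edges, b.map Function.Embedding.inr = e)}
  two_le_card := by
    rintro e (⟨a, ha, rfl⟩ | ⟨b, hb, rfl⟩)
    · simpa using H.two_le_card a ha
    · simpa using G.two_le_card b hb

/-- A hypergraph is discrete if it has no edges. -/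
def IsDiscrete (H : FinHypergraph V) : Prop := H.edges = ∅

/-- The discrete hypergraph on `V`. -/
def discrete (V : Type u) : FinHypergraph V := ⟨∅, by simp⟩

/-- Isomorphism: a bijection of vertex sets that preserves and reflects edges. -/
def Iso (H : FinHypergraph V) (G : FinHypergraph W) : Prop :=
  ∃ f : V ≃ W, ∀ e : Finset V, e ∈ H.edges ↔ e.map f.toEmbedding ∈ G.edges

theorem comap_comap (H : FinHypergraph V) (f : W ↪ V) (g : X ↪ W) :
    (H.comap f).comap g = H.comap (g.trans f) := by
  ext e; simp [comap, Finset.map_map]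

theorem iso_comap (G : FinHypergraph W) (f : V ≃ W) : (G.comap f.toEmbedding).Iso G :=
  ⟨f, fun _ => Iff.rfl⟩

theorem Iso.refl (H : FinHypergraph V) : H.Iso H := ⟨Equiv.refl V, by simp⟩

theorem Iso.symm {H : FinHypergraph V} {G : FinHypergraph W} : H.Iso G → G.Iso H := by
  rintro ⟨f, hf⟩
  refine ⟨f.symm, fun e => ?_⟩
  rw [hf, Finset.map_map]
  simp

theorem Iso.trans {H : FinHypergraph V} {G : FinHypergraph W} {K : FinHypergraph X} :
    H.Iso G → G.Iso K → H.Iso K := by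
  rintro ⟨f, hf⟩ ⟨g, hg⟩
  refine ⟨f.trans g, fun e => ?_⟩
  rw [hf, hg, Finset.map_map]
  rfl

theorem Iso.exists_eq_comap {H : FinHypergraph V} {G : FinHypergraph W} (h : H.Iso G) :
    ∃ f : V ≃ W, H = G.comap f.toEmbedding := by
  obtain ⟨f, hf⟩ := h
  exact ⟨f, by ext e; exact hf e⟩

theorem sum_comap {V' : Type*} {W' : Type*} (H : FinHypergraph V) (G : FinHypergraph W)
    (f : V' ↪ V) (g : W' ↪ W) :
    (H.sum G).comap (f.sumMap g) = (H.comap f).sum (G.comap g) := by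
  ext e
  constructor
  · rintro (⟨a, ha, h⟩ | ⟨a, ha, h⟩)
    · left
      have h2 : e.toRight = ∅ := by
        ext x
        simp only [Finset.mem_toRight, Finset.notMem_empty, iff_false]
        intro hx
        have : Sum.inr (g x) ∈ e.map (f.sumMap g) :=
          Finset.mem_map.2 ⟨_, hx, rfl⟩
        rw [← h] at this
        simp at this
      have h3 : e = e.toLeft.map Function.Embedding.inl := by
        conv_lhs => rw [← Finset.toLeft_disjSum_toRight (u := e), h2]
        simp
      refine ⟨e.toLeft, ?_, h3.symm⟩
      rw [h3, Finset.map_map] at h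
      have h4 : a = e.toLeft.map f := by
        apply Finset.map_injective (Function.Embedding.inl (β := W))
        rw [h, Finset.map_map]; rfl
      simpa [comap, ← h4] using ha
    · right
      have h2 : e.toLeft = ∅ := by
        ext x
        simp only [Finset.mem_toLeft, Finset.notMem_empty, iff_false]
        intro hx
        have : Sum.inl (f x) ∈ e.map (f.sumMap g) :=
          Finset.mem_map.2 ⟨_, hx, rfl⟩
        rw [← h] at this
        simp at this
      have h3 : e = e.toRight.map Function.Embedding.inr := by
        conv_lhs => rw [← Finset.toLeft_disjSum_toRight (u := e), h2]
        simp
      refine ⟨e.toRight, ?_, h3.symm⟩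
      rw [h3, Finset.map_map] at h
      have h4 : a = e.toRight.map g := by
        apply Finset.map_injective (Function.Embedding.inr (α := V))
        rw [h, Finset.map_map]; rfl
      simpa [comap, ← h4] using ha
  · rintro (⟨a, ha, rfl⟩ | ⟨a, ha, rfl⟩)
    · exact Or.inl ⟨_, ha, by simp only [Finset.map_map]; rfl⟩
    · exact Or.inr ⟨_, ha, by simp only [Finset.map_map]; rfl⟩

theorem Iso.sum {V' : Type*} {W' : Type*} {H : FinHypergraph V} {G : FinHypergraph W}
    {H' : FinHypergraph V'} {G' : FinHypergraph W'} (h : H.Iso H') (g : G.Iso G') :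
    (H.sum G).Iso (H'.sum G') := by
  obtain ⟨f, rfl⟩ := h.exists_eq_comap
  obtain ⟨g', rfl⟩ := g.exists_eq_comap
  rw [← sum_comap]
  exact iso_comap _ (Equiv.sumCongr f g')

theorem sum_comm_iso (H : FinHypergraph V) (G : FinHypergraph W) : (H.sum G).Iso (G.sum H) := by
  have key : ∀ {V : Type _} {W : Type _} (H : FinHypergraph V) (G : FinHypergraph W) e,
      e ∈ (H.sum G).edges → e.map (Equiv.sumComm V W).toEmbedding ∈ (G.sum H).edges := by
    rintro V W H G e (⟨a, ha, rfl⟩ | ⟨a, ha, rfl⟩)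
    · exact Or.inr ⟨_, ha, by simp only [Finset.map_map]; rfl⟩
    · exact Or.inl ⟨_, ha, by simp only [Finset.map_map]; rfl⟩
  refine ⟨Equiv.sumComm V W, fun e => ⟨key H G e, fun h => ?_⟩⟩
  rcases h with (⟨a, ha, h⟩ | ⟨a, ha, h⟩)
  · refine Or.inr ⟨_, ha, ?_⟩
    apply Finset.map_injective (Equiv.sumComm V W).toEmbedding
    rw [← h, Finset.map_map]; rfl
  · refine Or.inl ⟨_, ha, ?_⟩
    apply Finset.map_injective (Equiv.sumComm V W).toEmbedding
    rw [← h, Finset.map_map]; rfl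

theorem sum_assoc_iso (H : FinHypergraph V) (G : FinHypergraph W) (K : FinHypergraph X) :
    ((H.sum G).sum K).Iso (H.sum (G.sum K)) := by
  refine ⟨Equiv.sumAssoc V W X, fun e => ⟨?_, ?_⟩⟩
  · rintro (⟨_, ⟨a, ha, rfl⟩ | ⟨a, ha, rfl⟩, rfl⟩ | ⟨a, ha, rfl⟩)
    · exact Or.inl ⟨_, ha, by simp only [Finset.map_map]; rfl⟩
    · exact Or.inr ⟨_, Or.inl ⟨_, ha, rfl⟩, by simp only [Finset.map_map]; rfl⟩
    · exact Or.inr ⟨_, Or.inr ⟨_, ha, rfl⟩, by simp only [Finset.map_map]; rfl⟩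
  · rintro (⟨a, ha, h⟩ | ⟨_, ⟨a, ha, rfl⟩ | ⟨a, ha, rfl⟩, h⟩)
    · refine Or.inl ⟨_, Or.inl ⟨_, ha, rfl⟩, ?_⟩
      apply Finset.map_injective (Equiv.sumAssoc V W X).toEmbedding
      rw [← h]; simp only [Finset.map_map]; rfl
    · refine Or.inl ⟨_, Or.inr ⟨_, ha, rfl⟩, ?_⟩
      apply Finset.map_injective (Equiv.sumAssoc V W X).toEmbedding
      rw [← h]; simp only [Finset.map_map]; rfl
    · refine Or.inr ⟨_, ha, ?_⟩
      apply Finset.map_injective (Equiv.sumAssoc V W X).toEmbedding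
      rw [← h]; simp only [Finset.map_map]; rfl

theorem sum_empty_iso [IsEmpty W] (H : FinHypergraph V) (G : FinHypergraph W) :
    (H.sum G).Iso H := by
  refine ⟨Equiv.sumEmpty V W, fun e => ⟨?_, fun h => Or.inl ⟨_, h, ?_⟩⟩⟩
  · rintro (⟨a, ha, rfl⟩ | ⟨a, ha, rfl⟩)
    · rw [Finset.map_map]
      exact (congrArg (· ∈ H.edges) (Finset.map_refl (s := a))).mpr ha
    · have := G.two_le_card a ha
      rw [Finset.eq_empty_of_isEmpty a] at this
      simp at this
  · ext x
    rcases x with x | x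
    · simp [Equiv.sumEmpty]
    · exact isEmptyElim x

end FinHypergraph

/-- Isomorphism, on the hypergraphs with vertex set `Fin n` for some `n`. -/
def HypClass.setoid : Setoid (Σ n : ℕ, FinHypergraph (Fin n)) where
  r H G := H.2.Iso G.2
  iseqv := ⟨fun H => .refl H.2, fun h => h.symm, fun h g => h.trans g⟩

/-- The set of isomorphism classes of finite hypergraphs. -/
def HypClass : Type := Quotient HypClass.setoid

namespace FinHypergraph

variable {V : Type u} {W : Type v} {X : Type w}

/-- The isomorphism class of a hypergraph on an arbitrary finite vertex set. -/
def cls [Fintype V] (H : FinHypergraph V) : HypClass :=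
  Quotient.mk HypClass.setoid ⟨Fintype.card V, H.comap (Fintype.equivFin V).symm.toEmbedding⟩

theorem cls_eq_iff [Fintype V] [Fintype W] (H : FinHypergraph V) (G : FinHypergraph W) :
    H.cls = G.cls ↔ H.Iso G := by
  have h1 : (H.comap (Fintype.equivFin V).symm.toEmbedding).Iso H := iso_comap _ _
  have h2 : (G.comap (Fintype.equivFin W).symm.toEmbedding).Iso G := iso_comap _ _
  refine Quotient.eq.trans ⟨fun h => (h1.symm.trans h).trans h2, fun h => (h1.trans h).trans h2.symm⟩

end FinHypergraph

namespace HypClass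
open FinHypergraph

theorem exists_cls (x : HypClass) : ∃ (n : ℕ) (H : FinHypergraph (Fin n)), x = H.cls := by
  obtain ⟨⟨n, H⟩, rfl⟩ := Quotient.exists_rep x
  refine ⟨n, H, Quotient.sound ?_⟩
  exact (iso_comap H (Fintype.equivFin (Fin n)).symm).symm

/-- A function defined on isomorphism classes by an isomorphism-invariant formula. -/
def lift {α : Type*} (f : ∀ n : ℕ, FinHypergraph (Fin n) → α)
    (hf : ∀ (n m : ℕ) (H : FinHypergraph (Fin n)) (G : FinHypergraph (Fin m)),
      H.Iso G → f n H = f m G) (x : HypClass) : α :=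
  Quotient.lift (fun H => f H.1 H.2) (fun H G h => hf _ _ H.2 G.2 h) x

theorem lift_cls {α : Type*} (f : ∀ n : ℕ, FinHypergraph (Fin n) → α)
    (hf : ∀ (n m : ℕ) (H : FinHypergraph (Fin n)) (G : FinHypergraph (Fin m)),
      H.Iso G → f n H = f m G) {n : ℕ} (H : FinHypergraph (Fin n)) :
    lift f hf H.cls = f n H :=
  hf _ _ _ _ (iso_comap H (Fintype.equivFin (Fin n)).symm)

/-- The class of the hypergraph on the empty vertex set. -/
instance : Zero HypClass := ⟨(discrete (Fin 0)).cls⟩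

/-- Disjoint sum of isomorphism classes; see `cls_add`. -/
instance : Add HypClass :=
  ⟨Quotient.map₂ (fun H G => ⟨Fintype.card (Fin H.1 ⊕ Fin G.1),
      (H.2.sum G.2).comap (Fintype.equivFin (Fin H.1 ⊕ Fin G.1)).symm.toEmbedding⟩)
    (fun _ _ h _ _ g => ((iso_comap _ _).trans (h.sum g)).trans (iso_comap _ _).symm)⟩

theorem cls_add {V : Type u} {W : Type v} [Fintype V] [Fintype W]
    (H : FinHypergraph V) (G : FinHypergraph W) : H.cls + G.cls = (H.sum G).cls :=
  Quotient.sound (((iso_comap _ _).trans ((iso_comap H _).sum (iso_comap G _))).trans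
    (iso_comap _ _).symm)

instance : AddCommMonoid HypClass where
  add_assoc x y z := by
    obtain ⟨a, H, rfl⟩ := exists_cls x
    obtain ⟨b, G, rfl⟩ := exists_cls y
    obtain ⟨c, K, rfl⟩ := exists_cls z
    simp only [cls_add]
    exact (cls_eq_iff _ _).2 (sum_assoc_iso H G K)
  add_comm x y := by
    obtain ⟨a, H, rfl⟩ := exists_cls x
    obtain ⟨b, G, rfl⟩ := exists_cls y
    simp only [cls_add]
    exact (cls_eq_iff _ _).2 (sum_comm_iso H G)
  add_zero x := by
    obtain ⟨a, H, rfl⟩ := exists_cls x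
    exact (cls_add _ _).trans ((cls_eq_iff _ _).2 (sum_empty_iso H _))
  zero_add x := by
    obtain ⟨a, H, rfl⟩ := exists_cls x
    exact (cls_add _ _).trans ((cls_eq_iff _ _).2 ((sum_comm_iso _ _).trans (sum_empty_iso H _)))
  nsmul := nsmulRec

theorem cls_of_isEmpty {V : Type u} [Fintype V] [IsEmpty V] (H : FinHypergraph V) :
    H.cls = 0 := by
  refine (cls_eq_iff _ _).2 ⟨Equiv.equivOfIsEmpty V (Fin 0), fun e => ?_⟩
  have : e ∉ H.edges := fun he => by
    have := H.two_le_card e he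
    rw [Finset.eq_empty_of_isEmpty e] at this
    simp at this
  simp [this, discrete]

/-- The number of vertices. -/
def card : HypClass →+ ℕ where
  toFun := lift (fun n _ => n) (fun n m H G ⟨f, _⟩ => by simpa using Fintype.card_congr f)
  map_zero' := rfl
  map_add' x y := by
    obtain ⟨⟨a, H⟩, rfl⟩ := Quotient.exists_rep x
    obtain ⟨⟨b, G⟩, rfl⟩ := Quotient.exists_rep y
    show Fintype.card (Fin a ⊕ Fin b) = a + b
    simp

theorem card_cls {V : Type u} [Fintype V] (H : FinHypergraph V) :
    card H.cls = Fintype.card V := rfl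

end HypClass


namespace FinHypergraph

variable {V : Type u} {W : Type v}

theorem cls_comap_equiv [Fintype V] [Fintype W] (H : FinHypergraph V) (e : W ≃ V) :
    (H.comap e.toEmbedding).cls = H.cls :=
  (cls_eq_iff _ _).2 (iso_comap _ _)

theorem cls_comap [Fintype W] (H : FinHypergraph V) (f : W ↪ V) :
    (H.comap f).cls = (H.restrict (Finset.univ.map f)).cls := by
  let e : W ≃ ↥(Finset.univ.map f) :=
    Equiv.ofBijective (fun x => ⟨f x, by simp⟩)
      ⟨fun x y h => by simpa using h, fun ⟨y, hy⟩ => by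
        obtain ⟨x, _, rfl⟩ := Finset.mem_map.1 hy
        exact ⟨x, rfl⟩⟩
  rw [← cls_comap_equiv (H.restrict (Finset.univ.map f)) e, restrict, comap_comap]
  rfl

theorem cls_restrict_congr (H : FinHypergraph V) {I J : Finset V} (h : I = J) :
    (H.restrict I).cls = (H.restrict J).cls := by rw [h]

theorem cls_restrict_univ [Fintype V] (H : FinHypergraph V) :
    (H.restrict Finset.univ).cls = H.cls := by
  have := cls_comap H (Function.Embedding.refl V)
  rw [Finset.map_refl] at this
  rw [← this]
  exact cls_comap_equiv H (Equiv.refl V)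

theorem cls_restrict_empty (H : FinHypergraph V) :
    (H.restrict ∅).cls = 0 := HypClass.cls_of_isEmpty _

theorem cls_restrict_restrict (H : FinHypergraph V) (I : Finset V) (J : Finset I) :
    ((H.restrict I).restrict J).cls =
      (H.restrict (J.map (Function.Embedding.subtype (· ∈ I)))).cls := by
  rw [restrict, restrict, comap_comap, cls_comap]
  apply cls_restrict_congr
  rw [← Finset.map_map]
  congr 1
  ext x; simp

theorem cls_comap_restrict (H : FinHypergraph V) (f : W ↪ V) (I : Finset W) :
    ((H.comap f).restrict I).cls = (H.restrict (I.map f)).cls := by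
  rw [restrict, comap_comap, cls_comap]
  apply cls_restrict_congr
  rw [← Finset.map_map]
  congr 1
  ext x; simp

theorem cls_sum_restrict (H : FinHypergraph V) (G : FinHypergraph W) (I : Finset V)
    (J : Finset W) :
    ((H.sum G).restrict (I.disjSum J)).cls = (H.restrict I).cls + (G.restrict J).cls := by
  rw [HypClass.cls_add, restrict, restrict, restrict, ← sum_comap, cls_comap, cls_comap]
  apply cls_restrict_congr
  ext x
  rcases x with x | x <;> simp

end FinHypergraph

/-- The `k`-vector space with basis the isomorphism classes of finite hypergraphs. Its product is
the linear extension of the disjoint sum of hypergraphs. -/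
def HypAlg (k : Type u) [Field k] : Type u := AddMonoidAlgebra k HypClass

namespace HypAlg
open FinHypergraph HypClass

variable (k : Type u) [Field k]

instance : CommRing (HypAlg k) := inferInstanceAs (CommRing (AddMonoidAlgebra k HypClass))
instance : Algebra k (HypAlg k) := inferInstanceAs (Algebra k (AddMonoidAlgebra k HypClass))

/-- The basis of isomorphism classes. -/
def basis : Module.Basis HypClass k (HypAlg k) := AddMonoidAlgebra.basis HypClass k

/-- The basis element of an isomorphism class. -/
def of (x : HypClass) : HypAlg k := AddMonoidAlgebra.single x 1

theorem basis_apply (x : HypClass) : basis k x = of k x := by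
  apply AddMonoidAlgebra.basis_apply

theorem of_zero : of k 0 = 1 := rfl

theorem of_add (x y : HypClass) : of k (x + y) = of k x * of k y :=
  ((AddMonoidAlgebra.single_mul_single x y (1 : k) 1).trans (by rw [one_mul]; rfl)).symm

/-- The algebra morphism with prescribed multiplicative values on the basis. -/
def liftAlg {B : Type v} [CommRing B] [Algebra k B] (f : HypClass → B) (h0 : f 0 = 1)
    (hadd : ∀ x y, f (x + y) = f x * f y) : HypAlg k →ₐ[k] B :=
  AddMonoidAlgebra.lift k B HypClass
    { toFun := fun x => f x.toAdd, map_one' := h0, map_mul' := fun _ _ => hadd _ _ }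

theorem liftAlg_of {B : Type v} [CommRing B] [Algebra k B] (f : HypClass → B) (h0 : f 0 = 1)
    (hadd : ∀ x y, f (x + y) = f x * f y) (x : HypClass) :
    liftAlg k f h0 hadd (of k x) = f x := by
  refine (AddMonoidAlgebra.lift_single _ _ _).trans ?_
  simp

theorem lin_ext {M : Type*} [AddCommMonoid M] [Module k M] {f g : HypAlg k →ₗ[k] M}
    (h : ∀ (n : ℕ) (H : FinHypergraph (Fin n)), f (of k H.cls) = g (of k H.cls)) : f = g := by
  refine (basis k).ext fun x => ?_
  obtain ⟨n, H, rfl⟩ := x.exists_cls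
  rw [basis_apply, h]

/-- The coproduct of a hypergraph: the sum over all vertex subsets `I` of `H|_I ⊗ H|_(V ∖ I)`. -/
def comulSum {V : Type v} [Fintype V] [DecidableEq V] (H : FinHypergraph V) :
    HypAlg k ⊗[k] HypAlg k :=
  ∑ I : Finset V, of k (H.restrict I).cls ⊗ₜ[k] of k (H.restrict Iᶜ).cls

theorem comulSum_congr {V : Type v} {W : Type w} [Fintype V] [DecidableEq V] [Fintype W]
    [DecidableEq W] {H : FinHypergraph V} {G : FinHypergraph W} (h : H.Iso G) :
    comulSum k H = comulSum k G := by
  obtain ⟨f, rfl⟩ := h.exists_eq_comap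
  refine Fintype.sum_equiv (Equiv.finsetCongr f) _ _ fun I => ?_
  rw [cls_comap_restrict, cls_comap_restrict]
  have : (Iᶜ).map f.toEmbedding = (I.map f.toEmbedding)ᶜ := by
    ext x; simp
  rw [this]; rfl

/-- `comulSum` on isomorphism classes. -/
def comulClass : HypClass → HypAlg k ⊗[k] HypAlg k :=
  HypClass.lift (fun _ H => comulSum k H) (fun _ _ _ _ h => comulSum_congr k h)

theorem comulClass_cls {V : Type v} [Fintype V] [DecidableEq V] (H : FinHypergraph V) :
    comulClass k H.cls = comulSum k H := by
  rw [← cls_comap_equiv H (Fintype.equivFin V).symm]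
  exact (lift_cls _ _ _).trans (comulSum_congr k (iso_comap _ _))

theorem comulClass_zero : comulClass k 0 = 1 := by
  refine (lift_cls _ _ _).trans ?_
  rw [comulSum, Fintype.sum_eq_single ∅ (fun x hx => (hx (Finset.eq_empty_of_isEmpty x)).elim)]
  rw [cls_of_isEmpty, cls_of_isEmpty]
  rfl

theorem comulClass_add (x y : HypClass) :
    comulClass k (x + y) = comulClass k x * comulClass k y := by
  obtain ⟨n, H, rfl⟩ := x.exists_cls
  obtain ⟨m, G, rfl⟩ := y.exists_cls
  rw [cls_add, comulClass_cls, comulClass_cls, comulClass_cls, comulSum, comulSum, comulSum,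
    Finset.sum_mul_sum, ← Fintype.sum_prod_type']
  refine Fintype.sum_equiv Finset.sumEquiv.toEquiv _ _ fun I => ?_
  have h1 : I = I.toLeft.disjSum I.toRight := Finset.toLeft_disjSum_toRight.symm
  have h2 : Iᶜ = (I.toLeftᶜ).disjSum (I.toRightᶜ) := by
    ext x; rcases x with x | x <;> simp
  rw [cls_restrict_congr _ h2, cls_restrict_congr _ h1, cls_sum_restrict, cls_sum_restrict]
  rw [of_add, of_add, Algebra.TensorProduct.tmul_mul_tmul]
  rfl

/-- The coproduct; see `comulHom_cls`. -/
def comulHom : HypAlg k →ₐ[k] HypAlg k ⊗[k] HypAlg k :=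
  liftAlg k (comulClass k) (comulClass_zero k) (comulClass_add k)

theorem comulHom_cls {V : Type v} [Fintype V] [DecidableEq V] (H : FinHypergraph V) :
    comulHom k (of k H.cls) = ∑ I : Finset V, of k (H.restrict I).cls ⊗ₜ of k (H.restrict Iᶜ).cls :=
  (liftAlg_of ..).trans (comulClass_cls k H)

/-- The counit: `1` on the hypergraph with no vertices, `0` on all others. -/
def counitHom : HypAlg k →ₐ[k] k :=
  liftAlg k (fun x => if x.card = 0 then 1 else 0) (by simp) (fun x y => by
    by_cases hx : x.card = 0 <;> by_cases hy : y.card = 0 <;> simp [hx, hy])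

theorem counitHom_cls {V : Type v} [Fintype V] (H : FinHypergraph V) :
    counitHom k (of k H.cls) = if Fintype.card V = 0 then 1 else 0 :=
  liftAlg_of ..

theorem comulHom_restrict {V : Type v} [DecidableEq V] (H : FinHypergraph V)
    (I : Finset V) :
    comulHom k (of k (H.restrict I).cls) =
      ∑ J ∈ I.powerset, of k (H.restrict J).cls ⊗ₜ of k (H.restrict (I \ J)).cls := by
  rw [comulHom_cls]
  refine Finset.sum_bij' (fun J _ => J.map (Function.Embedding.subtype (· ∈ I)))
    (fun J _ => J.subtype (· ∈ I)) ?_ ?_ ?_ ?_ ?_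
  · intro J _
    simp only [Finset.mem_powerset]
    intro x hx
    obtain ⟨y, _, rfl⟩ := Finset.mem_map.1 hx
    exact y.2
  · simp
  · intro J _
    ext x; simp
  · intro J hJ
    ext x
    simp only [Finset.mem_powerset] at hJ
    simp only [Finset.subtype_map, Finset.mem_filter, and_iff_left_iff_imp]
    exact fun h => hJ h
  · intro J _
    rw [cls_restrict_restrict, cls_restrict_restrict]
    rw [cls_restrict_congr H (I := Jᶜ.map _)
      (J := I \ J.map (Function.Embedding.subtype (· ∈ I))) (by ext x; simp; tauto)]

theorem counit_restrict {V : Type v} [DecidableEq V] (H : FinHypergraph V) (I : Finset V) :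
    counitHom k (of k (H.restrict I).cls) = if I = ∅ then 1 else 0 := by
  rw [counitHom_cls]
  simp

/-- The bialgebra of hypergraphs; `comul_cls` and `counit_cls` give its structure maps. -/
instance : Bialgebra k (HypAlg k) :=
  Bialgebra.ofAlgHom (comulHom k) (counitHom k)
    (by
      refine AlgHom.toLinearMap_injective (lin_ext k fun n H => ?_)
      simp only [AlgHom.toLinearMap_apply, AlgHom.comp_apply]
      rw [comulHom_cls]
      simp only [map_sum, Algebra.TensorProduct.map_tmul, comulHom_restrict, TensorProduct.sum_tmul,
        TensorProduct.tmul_sum, AlgHom.id_apply]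
      simp only [AlgEquiv.coe_toAlgHom, Algebra.TensorProduct.assoc_tmul]
      rw [Finset.sum_sigma', Finset.sum_sigma']
      refine Finset.sum_bij' (fun p _ => ⟨p.2, p.1 \ p.2⟩) (fun p _ => ⟨p.1 ∪ p.2, p.1⟩)
        ?_ ?_ ?_ ?_ ?_
      · rintro ⟨I, J⟩ h
        simp only [Finset.mem_sigma, Finset.mem_univ, Finset.mem_powerset, true_and] at h ⊢
        intro x; simp
      · rintro ⟨I, J⟩ h
        exact Finset.mem_sigma.2
          ⟨Finset.mem_univ _, Finset.mem_powerset.2 Finset.subset_union_left⟩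
      · rintro ⟨I, J⟩ h
        simp only [Finset.mem_sigma, Finset.mem_univ, Finset.mem_powerset, true_and] at h
        simp [h]
      · rintro ⟨I, J⟩ h
        simp only [Finset.mem_sigma, Finset.mem_univ, Finset.mem_powerset, true_and] at h
        have : Disjoint I J := by
          rw [Finset.disjoint_left]; intro x hx hJ
          simpa [hx] using h hJ
        simp [Finset.union_sdiff_cancel_left this]
      · rintro ⟨I, J⟩ h
        simp only [Finset.mem_sigma, Finset.mem_univ, Finset.mem_powerset, true_and] at h
        rw [cls_restrict_congr H (I := Jᶜ \ (I \ J)) (J := Iᶜ)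
          (by ext x; have := @h x; simp; tauto)])
    (by
      refine AlgHom.toLinearMap_injective (lin_ext k fun n H => ?_)
      simp only [AlgHom.toLinearMap_apply, AlgHom.comp_apply, comulHom_cls, map_sum,
        Algebra.TensorProduct.map_tmul, counit_restrict, AlgHom.id_apply]
      rw [Fintype.sum_eq_single ∅ (by intro x hx; simp [hx]),
        cls_restrict_congr H (Finset.compl_empty), cls_restrict_univ]
      simp)
    (by
      refine AlgHom.toLinearMap_injective (lin_ext k fun n H => ?_)
      simp only [AlgHom.toLinearMap_apply, AlgHom.comp_apply, comulHom_cls, map_sum,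
        Algebra.TensorProduct.map_tmul, counit_restrict, AlgHom.id_apply]
      rw [Fintype.sum_eq_single Finset.univ (by intro x hx; simp [hx])]
      simp [cls_restrict_univ])

theorem comul_cls {V : Type v} [Fintype V] [DecidableEq V] (H : FinHypergraph V) :
    Coalgebra.comul (R := k) (of k H.cls) =
      ∑ I : Finset V, of k (H.restrict I).cls ⊗ₜ[k] of k (H.restrict Iᶜ).cls :=
  comulHom_cls k H

theorem counit_cls {V : Type v} [Fintype V] (H : FinHypergraph V) :
    Coalgebra.counit (R := k) (of k H.cls) = if Fintype.card V = 0 then 1 else 0 :=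
  counitHom_cls k H

instance : Coalgebra.IsCocomm k (HypAlg k) where
  comm_comp_comul := by
    refine lin_ext k fun n H => ?_
    simp only [LinearMap.comp_apply, comul_cls, map_sum, LinearEquiv.coe_coe,
      TensorProduct.comm_tmul]
    refine Finset.sum_nbij' (fun I => Iᶜ) (fun I => Iᶜ) (by simp) (by simp) (by simp) (by simp) ?_
    intro I _
    rw [cls_restrict_congr H (compl_compl I)]

end HypAlg

namespace CombHopf

/-! Notions for a graded Hopf algebra `A = ⊕ 𝒜 n` over `k` with a character `ζ`. -/

variable {k : Type u} [Field k] {A : Type v} [CommRing A] [HopfAlgebra k A]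
  (𝒜 : ℕ → Submodule k A) [GradedAlgebra 𝒜] (ζ : A →ₐ[k] k)

/-- The convolution product of two linear functionals. -/
def convolution (f g : A →ₗ[k] k) : A →ₗ[k] k :=
  LinearMap.mul' k k ∘ₗ TensorProduct.map f g ∘ₗ Coalgebra.comul

/-- The conjugate character, `(-1)^n ζ` on `𝒜 n`; see `conjugate_of_mem`. -/
def conjugate : A →ₗ[k] k :=
  DirectSum.toModule k ℕ k (fun n => (-1 : k) ^ n • (ζ.toLinearMap ∘ₗ (𝒜 n).subtype)) ∘ₗ
    (DirectSum.decomposeLinearEquiv 𝒜).toLinearMap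

theorem conjugate_of_mem {n : ℕ} {h : A} (hh : h ∈ 𝒜 n) : conjugate 𝒜 ζ h = (-1) ^ n * ζ h := by
  simp only [conjugate, LinearMap.comp_apply, LinearEquiv.coe_coe,
    DirectSum.decomposeLinearEquiv_apply, DirectSum.decompose_of_mem _ hh]
  simp [← DirectSum.lof_eq_of k]

/-- The convolution inverse `ζ⁻¹ = ζ ∘ S`. -/
def inverse : A →ₗ[k] k := ζ.toLinearMap ∘ₗ HopfAlgebra.antipode k

/-- The Euler character: the convolution product of the conjugate of `ζ` with `ζ`. -/
def eulerCharacter : A →ₗ[k] k := convolution (conjugate 𝒜 ζ) ζ.toLinearMap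

/-- The functional `ζ_n`: the projection onto `𝒜 n` followed by `ζ`. -/
def homPart (n : ℕ) : A →ₗ[k] k := ζ.toLinearMap ∘ₗ GradedAlgebra.proj 𝒜 n

/-- The functional `ζ_α = ζ_{a_1} * ⋯ * ζ_{a_m}` (convolution product) for a finite sequence
`α = (a_1, …, a_m)` of natural numbers; the empty product is the counit. -/
def zetaComp : List ℕ → A →ₗ[k] k
  | [] => Coalgebra.counit
  | a :: α => convolution (homPart 𝒜 ζ a) (zetaComp α)

/-- A subspace `B` is a graded Hopf subalgebra: it contains `1`, is closed under products, the
coproduct maps it into (the image of) `B ⊗ B`, and it is stable under the antipode and under taking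
homogeneous components. -/
structure IsGradedHopfSubalgebra (B : Submodule k A) : Prop where
  one_mem : (1 : A) ∈ B
  mul_mem : ∀ x ∈ B, ∀ y ∈ B, x * y ∈ B
  comul_mem : ∀ x ∈ B,
    Coalgebra.comul (R := k) x ∈ LinearMap.range (TensorProduct.map B.subtype B.subtype)
  antipode_mem : ∀ x ∈ B, HopfAlgebra.antipode k x ∈ B
  proj_mem : ∀ n, ∀ x ∈ B, GradedAlgebra.proj 𝒜 n x ∈ B

/-- The character is odd on `B`: there `ζ⁻¹` equals the conjugate of `ζ`. -/
def IsOddOn (B : Submodule k A) : Prop := ∀ x ∈ B, inverse ζ x = conjugate 𝒜 ζ x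

/-- The odd subalgebra: the largest graded Hopf subalgebra on which the character is odd. That the
supremum is itself such a Hopf subalgebra is `isGreatest_oddSubalgebra`. -/
def oddSubalgebra : Submodule k A :=
  sSup {B | IsGradedHopfSubalgebra 𝒜 B ∧ IsOddOn 𝒜 ζ B}

theorem conjugate_mul (x y : A) : conjugate 𝒜 ζ (x * y) = conjugate 𝒜 ζ x * conjugate 𝒜 ζ y := by
  induction x using DirectSum.Decomposition.inductionOn 𝒜 with
  | zero => simp
  | add a b ha hb => rw [add_mul, map_add, ha, hb, map_add, add_mul]
  | homogeneous a =>
    induction y using DirectSum.Decomposition.inductionOn 𝒜 with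
    | zero => simp
    | add c b hc hb => rw [mul_add, map_add, hc, hb, map_add, mul_add]
    | homogeneous b =>
      rw [conjugate_of_mem 𝒜 ζ (SetLike.mul_mem_graded a.2 b.2), conjugate_of_mem 𝒜 ζ a.2,
        conjugate_of_mem 𝒜 ζ b.2, map_mul, pow_add]
      ring

theorem conjugate_one : conjugate 𝒜 ζ 1 = 1 := by
  rw [conjugate_of_mem 𝒜 ζ (SetLike.one_mem_graded 𝒜)]; simp

theorem range_map_mono {B C : Submodule k A} (h : B ≤ C) :
    LinearMap.range (TensorProduct.map B.subtype B.subtype) ≤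
      LinearMap.range (TensorProduct.map C.subtype C.subtype) := by
  have : TensorProduct.map B.subtype B.subtype =
      TensorProduct.map C.subtype C.subtype ∘ₗ
        TensorProduct.map (Submodule.inclusion h) (Submodule.inclusion h) := by
    rw [← TensorProduct.map_comp]; rfl
  rw [this]
  exact LinearMap.range_comp_le_range _ _

theorem isGreatest_oddSubalgebra :
    IsGreatest {B | IsGradedHopfSubalgebra 𝒜 B ∧ IsOddOn 𝒜 ζ B} (oddSubalgebra 𝒜 ζ) := by
  set F : Set (Submodule k A) := {B | IsGradedHopfSubalgebra 𝒜 B ∧ IsOddOn 𝒜 ζ B} with hF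
  let T : Set A := ⋃ B ∈ F, (B : Set A)
  let C : Subalgebra k A := Algebra.adjoin k T
  have hT : ∀ {x}, x ∈ T → ∃ B ∈ F, x ∈ B := fun {x} hx => by simpa [T] using hx
  have hTC : ∀ B ∈ F, B ≤ Subalgebra.toSubmodule C := fun B hB x hx =>
    Algebra.subset_adjoin (Set.mem_biUnion hB hx)
  have hC : Subalgebra.toSubmodule C ∈ F := by
    refine ⟨⟨C.one_mem, fun x hx y hy => C.mul_mem hx hy, fun x hx => ?_, fun x hx => ?_,
      fun n x hx => ?_⟩, fun x hx => ?_⟩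
    · have h1 : C ≤ (Algebra.TensorProduct.map C.val C.val).range.comap
          (Bialgebra.comulAlgHom k A) := by
        refine Algebra.adjoin_le fun x hx => ?_
        obtain ⟨B, hB, hx⟩ := hT hx
        exact range_map_mono (hTC B hB) (hB.1.comul_mem x hx)
      exact h1 hx
    · have h1 : C ≤ C.comap (HopfAlgebra.antipodeAlgHom k A) := by
        refine Algebra.adjoin_le fun x hx => ?_
        obtain ⟨B, hB, hx⟩ := hT hx
        exact hTC B hB (hB.1.antipode_mem x hx)
      exact h1 hx
    · revert n
      have h1 : ∀ x ∈ C, ∀ n, GradedAlgebra.proj 𝒜 n x ∈ C := by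
        intro x hx
        induction hx using Algebra.adjoin_induction with
        | mem x hx =>
          intro n
          obtain ⟨B, hB, hx⟩ := hT hx
          exact hTC B hB (hB.1.proj_mem n x hx)
        | algebraMap r =>
          intro n
          rw [Algebra.algebraMap_eq_smul_one, map_smul]
          refine C.smul_mem ?_ _
          rw [GradedAlgebra.proj_apply]
          by_cases hn : n = 0
          · subst hn
            rw [DirectSum.decompose_of_mem_same 𝒜 (SetLike.one_mem_graded 𝒜)]
            exact C.one_mem
          · rw [DirectSum.decompose_of_mem_ne 𝒜 (SetLike.one_mem_graded 𝒜) (Ne.symm hn)]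
            exact C.zero_mem
        | add x y _ _ h1 h2 =>
          intro n
          rw [map_add]; exact C.add_mem (h1 n) (h2 n)
        | mul x y _ _ h1 h2 =>
          intro n
          classical
          rw [GradedAlgebra.proj_apply, DirectSum.decompose_mul,
            DirectSum.coe_mul_apply]
          refine C.sum_mem fun p _ => C.mul_mem ?_ ?_
          · simpa using h1 p.1
          · simpa using h2 p.2
      exact fun n => h1 x hx n
    · let f : A →ₐ[k] k := ζ.comp (HopfAlgebra.antipodeAlgHom k A)
      let g : A →ₐ[k] k := AlgHom.ofLinearMap (conjugate 𝒜 ζ) (conjugate_one 𝒜 ζ) (conjugate_mul 𝒜 ζ)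
      have h1 : C ≤ AlgHom.equalizer f g := by
        refine Algebra.adjoin_le fun x hx => ?_
        obtain ⟨B, hB, hx⟩ := hT hx
        exact hB.2 x hx
      exact h1 hx
  have heq : oddSubalgebra 𝒜 ζ = Subalgebra.toSubmodule C :=
    le_antisymm (sSup_le hTC) (le_sSup hC)
  rw [heq]
  exact ⟨hC, hTC⟩

end CombHopf

namespace HypAlg
open FinHypergraph HypClass WithConv

variable (k : Type u) [Field k]

/-- The map `π = id - u ∘ ε`. -/
def augProj : WithConv (HypAlg k →ₗ[k] HypAlg k) := toConv LinearMap.id - 1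

/-- The antipode `S = ∑_j (-1)^j π^{*j}`; on a hypergraph with `n` vertices the terms with `j > n`
vanish. -/
def antipodeMap : HypAlg k →ₗ[k] HypAlg k :=
  (basis k).constr k fun x =>
    ∑ j ∈ Finset.range (x.card + 1), (-1 : k) ^ j • (augProj k ^ j).ofConv (of k x)

theorem augProj_cls {V : Type v} [Fintype V] (H : FinHypergraph V) :
    (augProj k).ofConv (of k H.cls) = if Fintype.card V = 0 then 0 else of k H.cls := by
  have h : (augProj k).ofConv (of k H.cls) =
      of k H.cls - algebraMap k (HypAlg k) (Coalgebra.counit (R := k) (of k H.cls)) := rfl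
  rw [h, counit_cls]
  split_ifs with h0
  · have := Fintype.card_eq_zero_iff.1 h0
    rw [cls_of_isEmpty, of_zero, map_one, sub_self]
  · simp

theorem conv_cls (f g : WithConv (HypAlg k →ₗ[k] HypAlg k)) {V : Type v} [Fintype V]
    [DecidableEq V] (H : FinHypergraph V) :
    (f * g).ofConv (of k H.cls) =
      ∑ I : Finset V, f.ofConv (of k (H.restrict I).cls) * g.ofConv (of k (H.restrict Iᶜ).cls) := by
  have := LinearMap.convMul_apply f g (of k H.cls)
  rw [comul_cls] at this
  refine this.trans ?_
  simp [map_sum]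

theorem augProj_pow_cls (j : ℕ) : ∀ {V : Type v} [Fintype V] (H : FinHypergraph V),
    Fintype.card V < j → (augProj k ^ j).ofConv (of k H.cls) = 0 := by
  induction j with
  | zero => intro V _ H h; omega
  | succ j ih =>
    intro V _ H h
    classical
    rw [pow_succ', conv_cls]
    refine Finset.sum_eq_zero fun I _ => ?_
    rw [augProj_cls]
    split_ifs with h0
    · simp
    · rw [ih, mul_zero]
      have := Finset.card_add_card_compl I
      simp only [Fintype.card_coe] at h0 ⊢
      omega

theorem antipodeMap_cls {V : Type v} [Fintype V] (H : FinHypergraph V) (N : ℕ)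
    (hN : Fintype.card V ≤ N) :
    antipodeMap k (of k H.cls) =
      (∑ j ∈ Finset.range (N + 1), (-augProj k) ^ j).ofConv (of k H.cls) := by
  have h1 : antipodeMap k (of k H.cls) = ∑ j ∈ Finset.range (Fintype.card V + 1),
      (-1 : k) ^ j • (augProj k ^ j).ofConv (of k H.cls) := by
    rw [← basis_apply, antipodeMap, Module.Basis.constr_basis, card_cls, basis_apply]
  have h2 : ∀ j, ((-augProj k) ^ j).ofConv (of k H.cls) =
      (-1 : k) ^ j • (augProj k ^ j).ofConv (of k H.cls) := by
    intro j
    rcases Nat.even_or_odd j with h | h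
    · have := h.neg_pow (augProj k)
      rw [this, h.neg_one_pow, one_smul]
    · have := h.neg_pow (augProj k)
      rw [this, h.neg_one_pow, neg_one_smul]
      rfl
  have h3 : (∑ j ∈ Finset.range (N + 1), (-augProj k) ^ j).ofConv (of k H.cls) =
      ∑ j ∈ Finset.range (N + 1), ((-augProj k) ^ j).ofConv (of k H.cls) := by
    rw [ofConv_sum, LinearMap.sum_apply]
  rw [h1, h3]
  simp only [h2]
  refine Finset.sum_subset (fun x hx => ?_) (fun x _ hx => ?_)
  · simp at hx ⊢; omega
  · rw [augProj_pow_cls, smul_zero]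
    simp at hx; omega

theorem antipode_conv : toConv (antipodeMap k) * toConv LinearMap.id = 1 := by
  refine WithConv.ext (lin_ext k fun n H => ?_)
  have h1 : (toConv (antipodeMap k) * toConv LinearMap.id).ofConv (of k H.cls) =
      ((∑ j ∈ Finset.range (n + 1), (-augProj k) ^ j) * toConv LinearMap.id).ofConv
        (of k H.cls) := by
    rw [conv_cls, conv_cls]
    refine Finset.sum_congr rfl fun I _ => ?_
    rw [← antipodeMap_cls k (H.restrict I) n (by simpa using Finset.card_le_univ I)]
  have h2 : toConv LinearMap.id = 1 - (-augProj k) := by simp [augProj]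
  have h3 : (augProj k ^ (n + 1)).ofConv (of k H.cls) = 0 := augProj_pow_cls k _ H (by simp)
  have h4 : ((-augProj k) ^ (n + 1)).ofConv (of k H.cls) = 0 := by
    rcases Nat.even_or_odd (n + 1) with h | h
    · rw [h.neg_pow (augProj k), h3]
    · rw [h.neg_pow (augProj k)]
      exact (congrArg Neg.neg h3).trans neg_zero
  rw [h1, h2, geom_sum_mul_neg]
  simp [h4]

/-- The Hopf algebra of hypergraphs. -/
instance : HopfAlgebra k (HypAlg k) :=
  HopfAlgebra.ofConvInverse (antipodeMap k) (antipode_conv k)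
    (by rw [mul_comm]; exact antipode_conv k)

/-- The grading by the number of vertices. -/
def grading (n : ℕ) : Submodule k (HypAlg k) :=
  AddMonoidAlgebra.gradeBy k HypClass.card n

instance : GradedAlgebra (grading k) :=
  inferInstanceAs (GradedAlgebra (AddMonoidAlgebra.gradeBy k HypClass.card))

theorem proj_cls {V : Type v} [Fintype V] (H : FinHypergraph V) (n : ℕ) :
    GradedAlgebra.proj (grading k) n (of k H.cls) =
      if Fintype.card V = n then of k H.cls else 0 := by
  rw [GradedAlgebra.proj_apply]
  have hm : of k H.cls ∈ grading k (Fintype.card V) := AddMonoidAlgebra.single_mem_gradeBy _ _ _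
  split_ifs with h
  · subst h
    exact DirectSum.decompose_of_mem_same _ hm
  · exact DirectSum.decompose_of_mem_ne _ hm h


theorem isDiscrete_iso {V : Type v} {W : Type w} {H : FinHypergraph V} {G : FinHypergraph W}
    (h : H.Iso G) : H.IsDiscrete ↔ G.IsDiscrete := by
  obtain ⟨f, hf⟩ := h
  constructor
  · intro h
    refine Set.eq_empty_of_forall_notMem fun e he => ?_
    have h1 := (hf (e.map f.symm.toEmbedding)).2 (by simpa [Finset.map_map] using he)
    rw [h] at h1
    exact h1
  · intro h
    refine Set.eq_empty_of_forall_notMem fun e he => ?_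
    have h1 := (hf e).1 he
    rw [h] at h1
    exact h1

theorem isDiscrete_sum {V : Type v} {W : Type w} (H : FinHypergraph V) (G : FinHypergraph W) :
    (H.sum G).IsDiscrete ↔ H.IsDiscrete ∧ G.IsDiscrete := by
  simp only [FinHypergraph.IsDiscrete, Set.eq_empty_iff_forall_notMem]
  refine ⟨fun h => ⟨fun e he => h _ (Or.inl ⟨e, he, rfl⟩), fun e he => h _ (Or.inr ⟨e, he, rfl⟩)⟩,
    ?_⟩
  rintro ⟨h1, h2⟩ _ (⟨e, he, rfl⟩ | ⟨e, he, rfl⟩)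
  exacts [h1 _ he, h2 _ he]

open Classical in
/-- `1` on classes of discrete hypergraphs, `0` on all others. -/
def zetaClass : HypClass → k :=
  HypClass.lift (fun _ H => if H.IsDiscrete then 1 else 0)
    (fun _ _ _ _ h => by simp only [isDiscrete_iso h])

open Classical in
theorem zetaClass_cls {V : Type v} [Fintype V] (H : FinHypergraph V) :
    zetaClass k H.cls = if H.IsDiscrete then 1 else 0 := by
  rw [← cls_comap_equiv H (Fintype.equivFin V).symm]
  refine (lift_cls _ _ _).trans ?_
  simp only [isDiscrete_iso (iso_comap H (Fintype.equivFin V).symm)]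

/-- The character of the Hopf algebra of hypergraphs: `1` on discrete hypergraphs, `0` on all
others. -/
def zeta : HypAlg k →ₐ[k] k :=
  liftAlg k (zetaClass k)
    ((zetaClass_cls k (discrete (Fin 0))).trans (if_pos rfl))
    (fun x y => by
      obtain ⟨n, H, rfl⟩ := x.exists_cls
      obtain ⟨m, G, rfl⟩ := y.exists_cls
      rw [cls_add, zetaClass_cls, zetaClass_cls, zetaClass_cls]
      by_cases hx : H.IsDiscrete <;> by_cases hy : G.IsDiscrete <;> simp [isDiscrete_sum, hx, hy])

open Classical in
theorem zeta_cls {V : Type v} [Fintype V] (H : FinHypergraph V) :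
    zeta k (of k H.cls) = if H.IsDiscrete then 1 else 0 :=
  (liftAlg_of ..).trans (zetaClass_cls k H)

end HypAlg

namespace FinHypergraph
open CombHopf HypAlg
variable (k : Type u) [Field k]
/-- A hypergraph is eulerian if the Euler character agrees with the counit on all restrictions
`H|_I`. -/
def IsEulerian {V : Type v} (H : FinHypergraph V) : Prop :=
  ∀ I : Finset V, eulerCharacter (grading k) (zeta k) (of k (H.restrict I).cls) =
    Coalgebra.counit (R := k) (of k (H.restrict I).cls)

/-- The linear span of the isomorphism classes of eulerian hypergraphs. -/
def eulerianSubalgebra : Submodule k (HypAlg k) :=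
  Submodule.span k {x | ∃ (n : ℕ) (H : FinHypergraph (Fin n)), IsEulerian k H ∧ x = of k H.cls}
end FinHypergraph
end

/-!
The eulerian condition passes to restrictions, and on any hypergraph `H` a convolution product is
the sum `(f * g)(H) = ∑_I f(H|_I) g(H|_{V ∖ I})` (`convolution_cls`). Hence an identity between
functionals that holds on all eulerian hypergraphs may be convolved on either side with an
arbitrary functional. Oddness and the relations among the `ζ_α` come from this principle, the Hopf
subalgebra property from heredity and multiplicativity.

* The span of the eulerian classes is stable under products because the Euler character `χ` is
  multiplicative (`eulerCharacter_mul`) and `(H ⊔ G)|_I = H|_{I ∩ V} ⊔ G|_{I ∩ W}`. It is stable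
  under the antipode because this is an alternating sum of convolution powers of `id - u ∘ ε`,
  whose values on `H` are combinations of disjoint sums of restrictions of `H`.
* The character is odd on eulerian hypergraphs: there `χ = ζ̄ * ζ` equals the counit, so
  `ζ̄ = (ζ̄ * ζ) * ζ⁻¹ = ζ⁻¹` (`inverse_eq_conjugate_of_isEulerian`).
* The functional `∑_{j ≤ a} (-1)^j ζ_j * ζ_{a-j}` is the degree `a` part of `χ`
  (`sum_convolution_homPart_cls`). For `a ≥ 1` it vanishes on eulerian hypergraphs, hence so does
  its convolution with `ζ_β` on the left and `ζ_γ` on the right.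
-/

/-! ### Convolution of functionals -/

namespace CombHopf

variable {k : Type u} [Field k] {A : Type v} [CommRing A] [HopfAlgebra k A]
  (𝒜 : ℕ → Submodule k A) [GradedAlgebra 𝒜] (ζ : A →ₐ[k] k)

theorem convolution_assoc (f g h : A →ₗ[k] k) :
    convolution (convolution f g) h = convolution f (convolution g h) :=
  congrArg WithConv.ofConv
    (mul_assoc (WithConv.toConv f) (WithConv.toConv g) (WithConv.toConv h))

theorem convolution_inverse : convolution ζ.toLinearMap (inverse ζ) = Coalgebra.counit := by
  have h : LinearMap.mul' k k ∘ₗ TensorProduct.map ζ.toLinearMap (inverse ζ) =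
      ζ.toLinearMap ∘ₗ LinearMap.mul' k A ∘ₗ (HopfAlgebra.antipode k).lTensor A := by
    ext x y
    simp [inverse]
  ext x
  have h1 : convolution ζ.toLinearMap (inverse ζ) x = ζ (LinearMap.mul' k A
      ((HopfAlgebra.antipode k).lTensor A (Coalgebra.comul (R := k) x))) :=
    LinearMap.congr_fun h (Coalgebra.comul (R := k) x)
  rw [h1, HopfAlgebra.mul_antipode_lTensor_comul_apply]
  simp

/-- The Euler character as a convolution product of two characters, in the form of an algebra
morphism. -/
def eulerAlgHom : A →ₐ[k] k :=
  (Algebra.TensorProduct.lift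
    (AlgHom.ofLinearMap (conjugate 𝒜 ζ) (conjugate_one 𝒜 ζ) (conjugate_mul 𝒜 ζ)) ζ
    (fun _ _ => Commute.all _ _)).comp (Bialgebra.comulAlgHom k A)

theorem eulerAlgHom_apply (x : A) : eulerAlgHom 𝒜 ζ x = eulerCharacter 𝒜 ζ x := by
  have h : (Algebra.TensorProduct.lift
      (AlgHom.ofLinearMap (conjugate 𝒜 ζ) (conjugate_one 𝒜 ζ) (conjugate_mul 𝒜 ζ)) ζ
      (fun _ _ => Commute.all _ _)).toLinearMap =
      LinearMap.mul' k k ∘ₗ TensorProduct.map (conjugate 𝒜 ζ) ζ.toLinearMap := by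
    ext x y
    simp
  exact LinearMap.congr_fun h (Coalgebra.comul (R := k) x)

theorem eulerCharacter_one : eulerCharacter 𝒜 ζ 1 = 1 := by
  rw [← eulerAlgHom_apply, map_one]

theorem eulerCharacter_mul (x y : A) :
    eulerCharacter 𝒜 ζ (x * y) = eulerCharacter 𝒜 ζ x * eulerCharacter 𝒜 ζ y := by
  simp only [← eulerAlgHom_apply, map_mul]

end CombHopf

/-! ### Functionals on hypergraphs -/

namespace HypAlg
open FinHypergraph HypClass CombHopf

variable (k : Type u) [Field k]

theorem convolution_cls (f g : HypAlg k →ₗ[k] k) {V : Type v} [Fintype V] [DecidableEq V]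
    (H : FinHypergraph V) :
    convolution f g (of k H.cls) =
      ∑ I : Finset V, f (of k (H.restrict I).cls) * g (of k (H.restrict Iᶜ).cls) := by
  simp [convolution, comul_cls, map_sum]

theorem convolution_counit (f : HypAlg k →ₗ[k] k) : convolution f Coalgebra.counit = f := by
  refine lin_ext k fun n H => ?_
  rw [convolution_cls, Fintype.sum_eq_single Finset.univ]
  · simp [counit_cls, cls_restrict_univ]
  · intro I hI
    rw [counit_cls, if_neg, mul_zero]
    rwa [Fintype.card_coe, Finset.card_eq_zero, Finset.compl_eq_empty_iff]

theorem counit_convolution (f : HypAlg k →ₗ[k] k) : convolution Coalgebra.counit f = f := by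
  refine lin_ext k fun n H => ?_
  rw [convolution_cls, Fintype.sum_eq_single ∅]
  · rw [cls_restrict_congr H Finset.compl_empty, cls_restrict_univ]
    simp [counit_cls]
  · intro I hI
    simp [counit_cls, hI]

theorem homPart_cls {V : Type v} [Fintype V] (H : FinHypergraph V) (n : ℕ) :
    homPart (grading k) (zeta k) n (of k H.cls) =
      if Fintype.card V = n then zeta k (of k H.cls) else 0 := by
  simp only [homPart, LinearMap.comp_apply, AlgHom.toLinearMap_apply, proj_cls]
  split_ifs <;> simp

theorem conjugate_cls {V : Type v} [Fintype V] (H : FinHypergraph V) :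
    conjugate (grading k) (zeta k) (of k H.cls) =
      (-1) ^ Fintype.card V * zeta k (of k H.cls) :=
  conjugate_of_mem _ _ (AddMonoidAlgebra.single_mem_gradeBy _ _ _)

/-- The functional `∑_j (-1)^j ζ_j * ζ_{a-j}` is the homogeneous part of degree `a` of the Euler
character. -/
theorem sum_convolution_homPart_cls {V : Type v} [Fintype V] (H : FinHypergraph V) (a : ℕ) :
    ∑ j ∈ Finset.range (a + 1), (-1 : k) ^ j *
      convolution (homPart (grading k) (zeta k) j) (homPart (grading k) (zeta k) (a - j))
        (of k H.cls) =
      if Fintype.card V = a then eulerCharacter (grading k) (zeta k) (of k H.cls) else 0 := by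
  classical
  simp only [eulerCharacter, convolution_cls, homPart_cls, conjugate_cls, Finset.mul_sum]
  rw [Finset.sum_comm]
  have hc : ∀ I : Finset V, I.card + Iᶜ.card = Fintype.card V := Finset.card_add_card_compl
  split_ifs with h
  · refine Finset.sum_congr rfl fun I _ => ?_
    have hI := hc I
    -- Only the term with `j = |I|` survives.
    rw [Finset.sum_eq_single_of_mem I.card (Finset.mem_range.2 (by omega))
      (fun j _ hj => by simp [Ne.symm hj])]
    have h2 : Iᶜ.card = a - I.card := by omega
    rw [if_pos (Fintype.card_coe _), if_pos (by rw [Fintype.card_coe, h2]), Fintype.card_coe]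
    simp [mul_assoc]
  · refine Finset.sum_eq_zero fun I _ => Finset.sum_eq_zero fun j hj => ?_
    have hI := hc I
    have hj' := Finset.mem_range.1 hj
    by_cases h1 : I.card = j
    · have h2 : Iᶜ.card ≠ a - j := by omega
      simp only [Fintype.card_coe, if_neg h2, mul_zero]
    · simp only [Fintype.card_coe, if_neg h1, zero_mul, mul_zero]

end HypAlg

/-! ### Eulerian hypergraphs -/

namespace FinHypergraph
open CombHopf HypAlg

variable (k : Type u) [Field k]

theorem IsEulerian.comap {V : Type v} {W : Type w} {H : FinHypergraph V} (h : H.IsEulerian k)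
    (f : W ↪ V) : (H.comap f).IsEulerian k := by
  intro I
  rw [cls_comap_restrict]
  exact h _

theorem IsEulerian.restrict {V : Type v} {H : FinHypergraph V} (h : H.IsEulerian k)
    (I : Finset V) : (H.restrict I).IsEulerian k :=
  h.comap k _

theorem IsEulerian.eulerCharacter_eq {V : Type v} [Fintype V] {H : FinHypergraph V}
    (h : H.IsEulerian k) : eulerCharacter (grading k) (zeta k) (of k H.cls) =
      Coalgebra.counit (R := k) (of k H.cls) := by
  rw [← cls_restrict_univ]
  exact h _

theorem isEulerian_of_isEmpty {V : Type v} [IsEmpty V] (H : FinHypergraph V) :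
    H.IsEulerian k := by
  intro I
  rw [HypClass.cls_of_isEmpty, of_zero, eulerCharacter_one, Bialgebra.counit_one]

theorem IsEulerian.sum {V : Type v} {W : Type w} {H : FinHypergraph V} {G : FinHypergraph W}
    (hH : H.IsEulerian k) (hG : G.IsEulerian k) : (H.sum G).IsEulerian k := by
  intro I
  have h : I = I.toLeft.disjSum I.toRight := Finset.toLeft_disjSum_toRight.symm
  rw [cls_restrict_congr _ h, cls_sum_restrict, of_add, eulerCharacter_mul, Bialgebra.counit_mul,
    hH, hG]

theorem IsEulerian.of_cls_mem {V : Type v} [Fintype V] {H : FinHypergraph V}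
    (h : H.IsEulerian k) : of k H.cls ∈ eulerianSubalgebra k := by
  rw [← cls_comap_equiv H (Fintype.equivFin V).symm]
  exact Submodule.subset_span ⟨_, _, h.comap k _, rfl⟩

theorem eulerianSubalgebra_le {S : Submodule k (HypAlg k)}
    (h : ∀ (n : ℕ) (H : FinHypergraph (Fin n)), H.IsEulerian k → of k H.cls ∈ S) :
    eulerianSubalgebra k ≤ S := by
  refine Submodule.span_le.2 ?_
  rintro _ ⟨n, H, hH, rfl⟩
  exact h n H hH

theorem eulerianSubalgebra_mul_mem {x y : HypAlg k} (hx : x ∈ eulerianSubalgebra k)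
    (hy : y ∈ eulerianSubalgebra k) : x * y ∈ eulerianSubalgebra k := by
  refine eulerianSubalgebra_le k
    (S := (eulerianSubalgebra k).comap (LinearMap.mulRight k y)) (fun n H hH => ?_) hx
  refine eulerianSubalgebra_le k
    (S := (eulerianSubalgebra k).comap (LinearMap.mulLeft k (of k H.cls))) (fun m G hG => ?_) hy
  rw [Submodule.mem_comap, LinearMap.mulLeft_apply, ← of_add, HypClass.cls_add]
  exact (hH.sum k hG).of_cls_mem k

theorem IsEulerian.augProj_pow_mem (j : ℕ) : ∀ {V : Type v} [Fintype V] {H : FinHypergraph V},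
    H.IsEulerian k → (augProj k ^ j).ofConv (of k H.cls) ∈ eulerianSubalgebra k := by
  induction j with
  | zero =>
    intro V _ H _
    have h : (augProj k ^ 0).ofConv (of k H.cls) =
        algebraMap k (HypAlg k) (Coalgebra.counit (R := k) (of k H.cls)) := by
      rw [pow_zero]; rfl
    rw [h, Algebra.algebraMap_eq_smul_one, ← of_zero,
      ← HypClass.cls_of_isEmpty (discrete (Fin 0))]
    exact Submodule.smul_mem _ _ ((isEulerian_of_isEmpty k _).of_cls_mem k)
  | succ j ih =>
    intro V _ H hH
    classical
    rw [pow_succ', conv_cls]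
    refine Submodule.sum_mem _ fun I _ => eulerianSubalgebra_mul_mem k ?_ (ih (hH.restrict k _))
    rw [augProj_cls]
    split_ifs
    · exact Submodule.zero_mem _
    · exact (hH.restrict k _).of_cls_mem k

theorem isGradedHopfSubalgebra_eulerianSubalgebra :
    IsGradedHopfSubalgebra (grading k) (eulerianSubalgebra k) where
  one_mem := by
    rw [← of_zero, ← HypClass.cls_of_isEmpty (discrete (Fin 0))]
    exact (isEulerian_of_isEmpty k _).of_cls_mem k
  mul_mem x hx y hy := eulerianSubalgebra_mul_mem k hx hy
  comul_mem x hx := by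
    refine eulerianSubalgebra_le k
      (S := (LinearMap.range (TensorProduct.map (eulerianSubalgebra k).subtype
        (eulerianSubalgebra k).subtype)).comap Coalgebra.comul)
      (fun n H hH => ?_) hx
    rw [Submodule.mem_comap, comul_cls]
    refine Submodule.sum_mem _ fun I _ => ?_
    exact ⟨⟨_, (hH.restrict k I).of_cls_mem k⟩ ⊗ₜ ⟨_, (hH.restrict k Iᶜ).of_cls_mem k⟩, rfl⟩
  antipode_mem x hx := by
    refine eulerianSubalgebra_le k
      (S := (eulerianSubalgebra k).comap (HopfAlgebra.antipode k))
      (fun n H hH => ?_) hx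
    have h : HopfAlgebra.antipode k (of k H.cls) =
        ∑ j ∈ Finset.range (H.cls.card + 1), (-1 : k) ^ j • (augProj k ^ j).ofConv (of k H.cls) := by
      have h1 : HopfAlgebra.antipode k (of k H.cls) = antipodeMap k (of k H.cls) := rfl
      rw [h1, ← basis_apply, antipodeMap, Module.Basis.constr_basis, basis_apply]
    rw [Submodule.mem_comap, h]
    exact Submodule.sum_mem _ fun j _ => Submodule.smul_mem _ _ (hH.augProj_pow_mem k j)
  proj_mem n x hx := by
    refine eulerianSubalgebra_le k
      (S := (eulerianSubalgebra k).comap (GradedAlgebra.proj (grading k) n))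
      (fun m H hH => ?_) hx
    rw [Submodule.mem_comap, proj_cls]
    split_ifs
    · exact hH.of_cls_mem k
    · exact Submodule.zero_mem _

theorem inverse_eq_conjugate_of_isEulerian {V : Type v} [Fintype V] {H : FinHypergraph V}
    (hH : H.IsEulerian k) :
    inverse (zeta k) (of k H.cls) = conjugate (grading k) (zeta k) (of k H.cls) := by
  classical
  calc inverse (zeta k) (of k H.cls)
      = convolution Coalgebra.counit (inverse (zeta k)) (of k H.cls) := by
        rw [counit_convolution]
    _ = convolution (eulerCharacter (grading k) (zeta k)) (inverse (zeta k)) (of k H.cls) := by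
        rw [convolution_cls, convolution_cls]
        exact Finset.sum_congr rfl fun I _ => by rw [hH I]
    _ = conjugate (grading k) (zeta k) (of k H.cls) := by
        rw [eulerCharacter, convolution_assoc, convolution_inverse, convolution_counit]

theorem isOddOn_eulerianSubalgebra :
    IsOddOn (grading k) (zeta k) (eulerianSubalgebra k) :=
  eulerianSubalgebra_le k
    (S := LinearMap.eqLocus (inverse (zeta k)) (conjugate (grading k) (zeta k)))
    fun _ _ hH => inverse_eq_conjugate_of_isEulerian k hH

/-- The generalized Dehn–Sommerville relations: they hold for arbitrary sequences `β`, `γ` around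
the refined part `a`, without any condition on the total degree. -/
theorem IsEulerian.sum_zetaComp_eq_zero {a : ℕ} (ha : 0 < a) (γ : List ℕ) :
    ∀ (β : List ℕ) {V : Type v} [Fintype V] {H : FinHypergraph V}, H.IsEulerian k →
      ∑ j ∈ Finset.range (a + 1), (-1 : k) ^ j *
        zetaComp (grading k) (zeta k) (β ++ [j, a - j] ++ γ) (of k H.cls) = 0
  | [], V, _, H, hH => by
    classical
    simp only [List.nil_append, List.cons_append, zetaComp, ← convolution_assoc]
    simp only [convolution_cls k _ (zetaComp (grading k) (zeta k) γ), Finset.mul_sum]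
    rw [Finset.sum_comm]
    refine Finset.sum_eq_zero fun I _ => ?_
    simp only [← mul_assoc]
    rw [← Finset.sum_mul, sum_convolution_homPart_cls]
    split_ifs with h
    · rw [hH, counit_cls, if_neg (by omega), zero_mul]
    · rw [zero_mul]
  | b :: β, V, _, H, hH => by
    classical
    simp only [List.cons_append, zetaComp, convolution_cls, Finset.mul_sum]
    rw [Finset.sum_comm]
    refine Finset.sum_eq_zero fun I _ => ?_
    simp only [mul_left_comm _ (homPart (grading k) (zeta k) b _)]
    rw [← Finset.mul_sum, IsEulerian.sum_zetaComp_eq_zero ha γ β (hH.restrict k Iᶜ), mul_zero]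

end FinHypergraph

theorem mainTheorem4 (k : Type*) [Field k] :
    CombHopf.IsGradedHopfSubalgebra (HypAlg.grading k) (FinHypergraph.eulerianSubalgebra k) ∧
    FinHypergraph.eulerianSubalgebra k ≤
      CombHopf.oddSubalgebra (HypAlg.grading k) (HypAlg.zeta k) ∧
    ∀ (V : Type*) [Fintype V] (H : FinHypergraph V), H.IsEulerian k →
      ∀ (α : Composition (Fintype.card V)) (i : Fin α.length),
        ∑ j ∈ Finset.range (α.blocksFun i + 1), (-1 : k) ^ j *
          CombHopf.zetaComp (HypAlg.grading k) (HypAlg.zeta k)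
            (α.blocks.take i ++ [j, α.blocksFun i - j] ++ α.blocks.drop (i + 1))
            (HypAlg.of k H.cls) = 0 :=
  ⟨FinHypergraph.isGradedHopfSubalgebra_eulerianSubalgebra k,
    le_sSup ⟨FinHypergraph.isGradedHopfSubalgebra_eulerianSubalgebra k,
      FinHypergraph.isOddOn_eulerianSubalgebra k⟩,
    fun _ _ _ hH α i => hH.sum_zetaComp_eq_zero k (α.one_le_blocksFun i) _ _⟩
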